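/- Let $\mathbb K$ be a field. A Leibniz algebra over $\mathbb K$ is a $\mathbb K$-vector space $\mathfrak g$ with a bilinear bracket satisfying $[x,[y,z]]=[[x,y],z]-[[x,z],y]$ for all $x,y,z\in\mathfrak g$; its center is $Z(\mathfrak g)=\{c\in\mathfrak g \mid [x,c]=0=[c,x] \text{ for all } x\in\mathfrak g\}$. Every Lie algebra over $\mathbb K$ is a Leibniz algebra with the same bracket. A Lie algebra $L$ is called capable in the category of Lie algebras (respectively, of Leibniz algebras) if there is a Lie algebra (respectively, a Leibniz algebra) $\mathfrak q$ over $\mathbb K$ such that $L\cong\mathfrak q/Z(\mathfrak q)$. It is called perfect if $L=[L,L]$. Regard $\mathbb K$ as the one-dimensional Lie algebra with zero bracket. Let $L$ be a perfect Lie algebra over $\mathbb K$ (of any dimension). Then (i) $L\times\mathbb K$ is not capable in the category of Lie algebras; (ii) $L\times\mathbb K$ is capable in the category of Leibniz algebras if and only if $Z(L)=0$. In particular, over every field $\mathbb K$ there are Lie algebras other than the one-dimensional one that are capable in the category of Leibniz algebras but not capable in the category of Lie algebras. -/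

import Mathlib

/-- A (right) Leibniz algebra over a field `K`: a vector space with a bilinear bracket satisfying
`[x,[y,z]] = [[x,y],z] - [[x,z],y]`. -/
class LeibnizAlgebra (K : Type*) (g : Type*) [Field K] [AddCommGroup g] [Module K g] where
  /-- The Leibniz bracket, as a bilinear map. -/
  bracket : g →ₗ[K] g →ₗ[K] g
  leibniz : ∀ x y z : g,
    bracket x (bracket y z) = bracket (bracket x y) z - bracket (bracket x z) y

namespace LeibnizAlgebra

section Basic

variable (K : Type*) {g h : Type*} [Field K]
  [AddCommGroup g] [Module K g] [LeibnizAlgebra K g]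
  [AddCommGroup h] [Module K h] [LeibnizAlgebra K h]

/-- The center: all `c` with `[x,c] = 0 = [c,x]` for every `x`. -/
def center (g : Type*) [AddCommGroup g] [Module K g] [LeibnizAlgebra K g] : Submodule K g where
  carrier := {c | ∀ x : g, bracket (K := K) x c = 0 ∧ bracket (K := K) c x = 0}
  add_mem' ha hb x := by simp [ha x, hb x]
  zero_mem' x := by simp
  smul_mem' k a ha x := by simp [ha x]

/-- A subspace `I` is a two-sided ideal if `[a,x]` and `[x,a]` lie in `I` for `a ∈ I`. -/
def IsIdeal (I : Submodule K g) : Prop :=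
  ∀ a ∈ I, ∀ x : g, bracket (K := K) a x ∈ I ∧ bracket (K := K) x a ∈ I

theorem isIdeal_center : IsIdeal K (center K g) := by
  intro a ha x
  simp [ha x]

variable {K}

/-- The Leibniz algebra structure on the quotient by a two-sided ideal, with bracket
`[x + I, y + I] = [x,y] + I`. -/
@[reducible] def quotient (I : Submodule K g) (hI : IsIdeal K I) : LeibnizAlgebra K (g ⧸ I) where
  bracket := I.liftQ
    { toFun := fun x => I.mapQ I (bracket (K := K) x) fun a ha => (hI a ha x).2
      map_add' := fun x y => by ext; simp
      map_smul' := fun k x => by ext; simp }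
    (fun a ha => by
      ext x
      simpa using (hI a ha x).1)
  leibniz x y z := by
    obtain ⟨x, rfl⟩ := Submodule.Quotient.mk_surjective I x
    obtain ⟨y, rfl⟩ := Submodule.Quotient.mk_surjective I y
    obtain ⟨z, rfl⟩ := Submodule.Quotient.mk_surjective I z
    exact congrArg Submodule.Quotient.mk (leibniz (K := K) x y z)

theorem quotient_bracket_mk (I : Submodule K g) (hI : IsIdeal K I) (x y : g) :
    (quotient I hI).bracket (Submodule.Quotient.mk x) (Submodule.Quotient.mk y)
      = Submodule.Quotient.mk (bracket (K := K) x y) := rfl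

variable (K) in
instance quotientCenter (g : Type*) [AddCommGroup g] [Module K g] [LeibnizAlgebra K g] :
    LeibnizAlgebra K (g ⧸ center K g) :=
  quotient (center K g) (isIdeal_center K)

variable (K g h) in
/-- Two Leibniz algebras are isomorphic if there is a linear bijection preserving the bracket. -/
def Isomorphic : Prop :=
  ∃ e : g ≃ₗ[K] h, ∀ x y : g, e (bracket (K := K) x y) = bracket (K := K) (e x) (e y)

end Basic

/-- A Leibniz algebra `g` is capable (in the category of Leibniz algebras) if `g ≅ q / Z(q)` for
some Leibniz algebra `q`. The free universe level `w` lets `q` be as large as one likes. -/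
def IsCapable.{u, v, w} (K : Type u) (g : Type v) [Field K] [AddCommGroup g] [Module K g]
    [LeibnizAlgebra K g] : Prop :=
  ∃ (q : Type (max u v w)) (_ : AddCommGroup q) (_ : Module K q) (_ : LeibnizAlgebra K q),
    Isomorphic K g (q ⧸ center K q)

/-- Every Lie algebra is a Leibniz algebra, with the same bracket. -/
instance ofLieAlgebra (K L : Type*) [Field K] [LieRing L] [LieAlgebra K L] :
    LeibnizAlgebra K L where
  bracket := LinearMap.mk₂ K (fun x y : L => ⁅x, y⁆) add_lie smul_lie lie_add
    (fun c x y => lie_smul c x y)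
  leibniz x y z := by
    simp only [LinearMap.mk₂_apply]
    rw [leibniz_lie, ← lie_skew y ⁅x, z⁆]
    abel

end LeibnizAlgebra

/-- A Lie algebra `L` is capable (in the category of Lie algebras) if `L ≅ Q / Z(Q)` for some Lie
algebra `Q`. The free universe level `w` lets `Q` be as large as one likes. -/
def LieAlgebra.IsCapable.{u, v, w} (K : Type u) (L : Type v) [Field K] [LieRing L]
    [LieAlgebra K L] : Prop :=
  ∃ (Q : Type (max u v w)) (_ : LieRing Q) (_ : LieAlgebra K Q),
    Nonempty (L ≃ₗ⁅K⁆ Q ⧸ LieAlgebra.center K Q)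

/-- A Lie algebra `L` is perfect if `L = [L,L]`. -/
def LieAlgebra.IsPerfect (K L : Type*) [Field K] [LieRing L] [LieAlgebra K L] : Prop :=
  ⁅(⊤ : LieIdeal K L), (⊤ : LieIdeal K L)⁆ = ⊤

/-- The field `K` regarded as a one-dimensional Lie algebra over itself with zero bracket. -/
def AbelianLine (K : Type*) : Type _ := K

namespace AbelianLine

instance (K : Type*) [Field K] : AddCommGroup (AbelianLine K) :=
  inferInstanceAs (AddCommGroup K)

instance (K : Type*) [Field K] : Module K (AbelianLine K) :=
  inferInstanceAs (Module K K)

instance (K : Type*) [Field K] : LieRing (AbelianLine K) where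
  bracket _ _ := 0
  add_lie _ _ _ := (add_zero 0).symm
  lie_add _ _ _ := (add_zero 0).symm
  lie_self _ := rfl
  leibniz_lie _ _ _ := (add_zero 0).symm

instance (K : Type*) [Field K] : LieAlgebra K (AbelianLine K) where
  lie_smul t _ _ := (smul_zero t).symm

end AbelianLine

universe u v w

namespace LeibnizAlgebra

/-! Let `f : q → L × K` be onto with kernel `Z(q)`. If `f c` is central, bracketing with `c` has
values in `Z(q)`, so by the Leibniz identity it kills `[q,q]`; as `L` is perfect, `[q,q] + Z(q)` is
all of `f⁻¹(L × 0)`. Hence `c` is central as soon as it commutes with one lift `t` of `(0,1)`. If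
`q` is Lie, then `[t,t] = 0`, so `t` itself would be central, which is absurd. If `q` is Leibniz, a
lift `c` of a central `l ∈ L` lies over `L × 0`, hence commutes with `t`, and so `l = 0`.
Conversely, when `Z(L) = 0`, adjoining `z = [t,t]` gives an algebra with center `K z`. -/

theorem bracket_eq_lie {K L : Type*} [Field K] [LieRing L] [LieAlgebra K L] (x y : L) :
    bracket (K := K) x y = ⁅x, y⁆ := rfl

section CentralExtension

variable {K q M : Type*} [Field K] [AddCommGroup q] [Module K q] [LeibnizAlgebra K q]
  [AddCommGroup M] [Module K M] [LeibnizAlgebra K M]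

/-- A linear surjection of Leibniz algebras which preserves the bracket and has the center as its
kernel. -/
structure IsCenterQuotient (f : q →ₗ[K] M) : Prop where
  surjective : Function.Surjective f
  map_bracket : ∀ x y, f (bracket (K := K) x y) = bracket (K := K) (f x) (f y)
  ker_eq : LinearMap.ker f = center K q

theorem Isomorphic.exists_isCenterQuotient (h : Isomorphic K M (q ⧸ center K q)) :
    ∃ f : q →ₗ[K] M, IsCenterQuotient f := by
  obtain ⟨e, he⟩ := h
  refine ⟨e.symm.toLinearMap ∘ₗ (center K q).mkQ,
    e.symm.surjective.comp (Submodule.mkQ_surjective _), fun x y => ?_, ?_⟩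
  · apply e.injective
    rw [he]
    simp only [LinearMap.comp_apply, LinearEquiv.coe_coe, LinearEquiv.apply_symm_apply]
    rfl
  · rw [LinearEquiv.ker_comp, Submodule.ker_mkQ]

theorem IsCenterQuotient.isomorphic {f : q →ₗ[K] M} (hf : IsCenterQuotient f) :
    Isomorphic K M (q ⧸ center K q) := by
  let e : (q ⧸ center K q) ≃ₗ[K] M :=
    (Submodule.quotEquivOfEq _ _ hf.ker_eq.symm).trans
      (f.quotKerEquivOfSurjective hf.surjective)
  have he : ∀ x : q, e (Submodule.Quotient.mk x) = f x := fun x => rfl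
  refine ⟨e.symm, fun x y => ?_⟩
  obtain ⟨x, rfl⟩ := hf.surjective x
  obtain ⟨y, rfl⟩ := hf.surjective y
  rw [← hf.map_bracket, ← he, ← he, ← he]
  simp only [LinearEquiv.symm_apply_apply]
  rfl

theorem IsCenterQuotient.mem_center {f : q →ₗ[K] M} (hf : IsCenterQuotient f) {x : q} :
    f x = 0 ↔ x ∈ center K q := by
  rw [← hf.ker_eq, LinearMap.mem_ker]

/-- The elements annihilated by bracketing with `c` on either side. -/
def annihilator (K : Type*) {q : Type*} [Field K] [AddCommGroup q] [Module K q]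
    [LeibnizAlgebra K q] (c : q) : Submodule K q :=
  LinearMap.ker (bracket (K := K) c) ⊓ LinearMap.ker ((bracket (K := K) (g := q)).flip c)

theorem mem_annihilator {c x : q} :
    x ∈ annihilator K c ↔ bracket (K := K) c x = 0 ∧ bracket (K := K) x c = 0 := by
  simp [annihilator]

theorem mem_center_iff_annihilator_eq_top {c : q} :
    c ∈ center K q ↔ annihilator K c = ⊤ := by
  rw [Submodule.eq_top_iff']
  exact forall_congr' fun x => (and_comm.trans mem_annihilator.symm)

theorem center_le_annihilator (c : q) : center K q ≤ annihilator K c :=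
  fun _ hx => mem_annihilator.2 (hx c)

/-- An element that is central modulo the center annihilates all brackets. -/
theorem IsCenterQuotient.bracket_mem_annihilator {f : q →ₗ[K] M} (hf : IsCenterQuotient f)
    {c : q} (hc : f c ∈ center K M) (y z : q) : bracket (K := K) y z ∈ annihilator K c := by
  have h1 : ∀ x, bracket (K := K) x c ∈ center K q := fun x => by
    rw [← hf.mem_center, hf.map_bracket, (hc (f x)).1]
  have h2 : ∀ x, bracket (K := K) c x ∈ center K q := fun x => by
    rw [← hf.mem_center, hf.map_bracket, (hc (f x)).2]
  refine mem_annihilator.2 ⟨?_, ?_⟩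
  · rw [leibniz, (h2 y z).2, (h2 z y).2, sub_zero]
  · have h := leibniz (K := K) y z c
    rwa [(h1 z y).1, (h1 y z).2, sub_zero, eq_comm] at h

end CentralExtension

section ProductWithLine

variable {K L : Type*} [Field K] [LieRing L] [LieAlgebra K L]

theorem mem_span_lie_of_isPerfect (hL : LieAlgebra.IsPerfect K L) (l : L) :
    l ∈ Submodule.span K {m : L | ∃ a b : L, ⁅a, b⁆ = m} := by
  have h := LieSubmodule.lieIdeal_oper_eq_linear_span' (R := K) (⊤ : LieIdeal K L)
    (⊤ : LieIdeal K L)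
  rw [show ⁅(⊤ : LieIdeal K L), (⊤ : LieIdeal K L)⁆ = ⊤ from hL] at h
  have hl : l ∈ LieSubmodule.toSubmodule (⊤ : LieIdeal K L) := trivial
  rw [h] at hl
  simpa using hl

variable {q : Type*} [AddCommGroup q] [Module K q] [LeibnizAlgebra K q]
  {f : q →ₗ[K] L × AbelianLine K}

/-- Perfectness lifts each `(l, 0)` to a sum of brackets, which `c` annihilates; any other lift
differs by a central element. -/
theorem IsCenterQuotient.mem_annihilator_of_snd_eq_zero (hL : LieAlgebra.IsPerfect K L)
    (hf : IsCenterQuotient f) {c : q} (hc : f c ∈ center K (L × AbelianLine K)) {x : q}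
    (hx : (f x).2 = 0) : x ∈ annihilator K c := by
  have key : ∀ l : L, ∃ y ∈ annihilator K c, f y = (l, 0) := fun l => by
    induction mem_span_lie_of_isPerfect hL l using Submodule.span_induction with
    | mem l hl =>
      obtain ⟨a, b, rfl⟩ := hl
      obtain ⟨a', ha⟩ := hf.surjective (a, 0)
      obtain ⟨b', hb⟩ := hf.surjective (b, 0)
      refine ⟨_, hf.bracket_mem_annihilator hc a' b', ?_⟩
      rw [hf.map_bracket, ha, hb]
      rfl
    | zero => exact ⟨0, zero_mem _, map_zero f⟩
    | add l m _ _ hl hm =>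
      obtain ⟨y, hy, hyl⟩ := hl
      obtain ⟨z, hz, hzm⟩ := hm
      exact ⟨y + z, add_mem hy hz, by simp [hyl, hzm]⟩
    | smul k l _ hl =>
      obtain ⟨y, hy, hyl⟩ := hl
      exact ⟨k • y, Submodule.smul_mem _ k hy, by simp [hyl]⟩
  obtain ⟨y, hy, hyx⟩ := key (f x).1
  have hxy : x - y ∈ center K q := by
    rw [← hf.mem_center, map_sub, hyx, sub_eq_zero]
    exact Prod.ext rfl hx
  simpa using add_mem (center_le_annihilator c hxy) hy

/-- Modulo multiples of `t`, every element lies over `L × 0`, so `t` is the only obstruction to `c`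
being central. -/
theorem IsCenterQuotient.eq_zero_of_mem_annihilator (hL : LieAlgebra.IsPerfect K L)
    (hf : IsCenterQuotient f) {c t : q} (hc : f c ∈ center K (L × AbelianLine K))
    (ht : (f t).2 = (1 : K)) (htc : t ∈ annihilator K c) : f c = 0 := by
  rw [hf.mem_center, mem_center_iff_annihilator_eq_top, Submodule.eq_top_iff']
  intro x
  let k : K := (f x).2
  have h : x - k • t ∈ annihilator K c := by
    refine hf.mem_annihilator_of_snd_eq_zero hL hc ?_
    rw [map_sub, map_smul, Prod.snd_sub, Prod.smul_snd, ht]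
    exact sub_eq_zero.2 (mul_one k).symm
  simpa using add_mem h (Submodule.smul_mem _ k htc)

theorem mk_mem_center_prod {l : L} (hl : l ∈ LieAlgebra.center K L) (k : AbelianLine K) :
    (l, k) ∈ center K (L × AbelianLine K) := by
  intro x
  have h : ⁅x.1, l⁆ = 0 := hl x.1
  refine ⟨Prod.ext h rfl, Prod.ext ?_ rfl⟩
  change ⁅l, x.1⁆ = 0
  rw [← lie_skew, h, neg_zero]

theorem center_eq_bot_of_isCenterQuotient (hL : LieAlgebra.IsPerfect K L)
    (hf : IsCenterQuotient f) : LieAlgebra.center K L = ⊥ := by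
  rw [LieSubmodule.eq_bot_iff]
  intro l hl
  obtain ⟨c, hc⟩ := hf.surjective (l, 0)
  obtain ⟨t, ht⟩ := hf.surjective (0, (1 : K))
  have hcc : f c ∈ center K (L × AbelianLine K) := hc ▸ mk_mem_center_prod hl 0
  have htc : f t ∈ center K (L × AbelianLine K) := ht ▸ mk_mem_center_prod (zero_mem _) _
  -- The roles are swapped here: `t` is central modulo the center and `c` lies over `L × 0`.
  have hct : c ∈ annihilator K t := hf.mem_annihilator_of_snd_eq_zero hL htc (by rw [hc])
  have h := hf.eq_zero_of_mem_annihilator hL hcc (by rw [ht])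
    (mem_annihilator.2 (mem_annihilator.1 hct).symm)
  rw [hc] at h
  exact congrArg Prod.fst h

end ProductWithLine

/-- The Leibniz algebra `L ⊕ K t ⊕ K z` with `[t,t] = z` as the only further bracket. -/
@[reducible] def lineExtension (K : Type u) (L : Type v) [Field K] [LieRing L] [LieAlgebra K L] :
    LeibnizAlgebra K (L × K × ULift.{w} K) where
  bracket := LinearMap.mk₂ K (fun x y => (⁅x.1, y.1⁆, 0, ⟨x.2.1 * y.2.1⟩))
    (fun x y z => by ext <;> simp [add_mul])
    (fun k x y => by ext <;> simp [mul_assoc])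
    (fun x y z => by ext <;> simp [mul_add])
    (fun k x y => by ext <;> simp [mul_left_comm])
  leibniz x y z := by
    ext
    · exact (ofLieAlgebra K L).leibniz x.1 y.1 z.1
    · simp
    · simp

theorem isCapable_prod_line {K : Type u} {L : Type v} [Field K] [LieRing L] [LieAlgebra K L]
    (hZ : LieAlgebra.center K L = ⊥) :
    IsCapable.{u, max u v, w} K (L × AbelianLine K) := by
  let := lineExtension.{u, v, max u w} K L
  let p : (L × K × ULift.{max u w} K) →ₗ[K] L × AbelianLine K :=
    { toFun := fun x => (x.1, x.2.1)
      map_add' := fun _ _ => rfl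
      map_smul' := fun _ _ => rfl }
  refine ⟨L × K × ULift.{max u w} K, inferInstance, inferInstance, inferInstance,
    IsCenterQuotient.isomorphic (f := p) ⟨fun x => ⟨(x.1, x.2, 0), rfl⟩, fun _ _ => rfl, ?_⟩⟩
  ext c
  rw [LinearMap.mem_ker]
  constructor
  · intro hc x
    have h1 : c.1 = 0 := congrArg Prod.fst hc
    have h2 : c.2.1 = (0 : K) := congrArg Prod.snd hc
    change ((⁅x.1, c.1⁆, 0, ⟨x.2.1 * c.2.1⟩) : L × K × ULift.{max u w} K) = 0 ∧
      ((⁅c.1, x.1⁆, 0, ⟨c.2.1 * x.2.1⟩) : L × K × ULift.{max u w} K) = 0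
    rw [h1, h2, lie_zero, zero_lie, mul_zero, zero_mul]
    exact ⟨rfl, rfl⟩
  · intro hc
    have h1 : c.1 ∈ LieAlgebra.center K L := fun l => congrArg Prod.fst (hc (l, 0, 0)).1
    rw [hZ, LieSubmodule.mem_bot] at h1
    -- Bracketing with `t` copies the `t`-coordinate of `c` into the `z`-coordinate.
    have h2 : (1 : K) * c.2.1 = 0 :=
      congrArg (fun x : L × K × ULift.{max u w} K => x.2.2.down) (hc (0, 1, 0)).1
    rw [one_mul] at h2
    exact Prod.ext h1 h2

theorem center_ofLieAlgebra (K Q : Type*) [Field K] [LieRing Q] [LieAlgebra K Q] :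
    center K Q = (LieAlgebra.center K Q).toSubmodule := by
  ext c
  refine ⟨fun h x => (h x).1, fun h x => ⟨h x, ?_⟩⟩
  rw [bracket_eq_lie, ← lie_skew, show ⁅x, c⁆ = 0 from h x, neg_zero]

theorem exists_isCenterQuotient_of_lieEquiv {K L Q : Type*} [Field K] [LieRing L]
    [LieAlgebra K L] [LieRing Q] [LieAlgebra K Q] (e : L ≃ₗ⁅K⁆ Q ⧸ LieAlgebra.center K Q) :
    ∃ f : Q →ₗ[K] L, IsCenterQuotient f := by
  refine ⟨e.symm.toLinearEquiv.toLinearMap ∘ₗ (LieAlgebra.center K Q).toSubmodule.mkQ,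
    e.symm.surjective.comp (Submodule.mkQ_surjective _), fun x y => ?_, ?_⟩
  · exact e.symm.map_lie (LieSubmodule.Quotient.mk x) (LieSubmodule.Quotient.mk y)
  · rw [LinearEquiv.ker_comp, Submodule.ker_mkQ, center_ofLieAlgebra]

end LeibnizAlgebra

theorem LieAlgebra.not_isCapable_prod_line {K : Type u} {L : Type v} [Field K] [LieRing L]
    [LieAlgebra K L] (hL : LieAlgebra.IsPerfect K L) :
    ¬ LieAlgebra.IsCapable.{u, max u v, w} K (L × AbelianLine K) := by
  rintro ⟨Q, _, _, ⟨e⟩⟩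
  obtain ⟨f, hf⟩ := LeibnizAlgebra.exists_isCenterQuotient_of_lieEquiv e
  obtain ⟨t, ht⟩ := hf.surjective (0, (1 : K))
  have h := hf.eq_zero_of_mem_annihilator hL
    (ht ▸ LeibnizAlgebra.mk_mem_center_prod (zero_mem _) _) (by rw [ht])
    -- The alternating law `[t,t] = 0` is what fails for Leibniz algebras.
    (LeibnizAlgebra.mem_annihilator.2 ⟨lie_self t, lie_self t⟩)
  rw [ht] at h
  exact one_ne_zero (α := K) (congrArg Prod.snd h)

theorem LeibnizAlgebra.isCapable_prod_line_iff {K : Type u} {L : Type v} [Field K] [LieRing L]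
    [LieAlgebra K L] (hL : LieAlgebra.IsPerfect K L) :
    LeibnizAlgebra.IsCapable.{u, max u v, w} K (L × AbelianLine K) ↔
      LieAlgebra.center K L = ⊥ := by
  refine ⟨?_, isCapable_prod_line⟩
  rintro ⟨q, _, _, _, h⟩
  obtain ⟨f, hf⟩ := h.exists_isCenterQuotient
  exact center_eq_bot_of_isCenterQuotient hL hf

/-- The cross product gives a nonzero perfect centerless Lie algebra over every field. -/
theorem LieAlgebra.exists_isPerfect_center_eq_bot (K : Type u) [Field K] :
    ∃ (L : Type u) (_ : LieRing L) (_ : LieAlgebra K L), Nontrivial L ∧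
      LieAlgebra.IsPerfect K L ∧ LieAlgebra.center K L = ⊥ := by
  let : LieRing (Fin 3 → K) := Cross.lieRing
  let : LieAlgebra K (Fin 3 → K) :=
    { (inferInstance : Module K (Fin 3 → K)) with
      lie_smul := fun k x y => (crossProduct x).map_smul k y }
  have hlie : ∀ x y : Fin 3 → K, ⁅x, y⁆ =
      ![x 1 * y 2 - x 2 * y 1, x 2 * y 0 - x 0 * y 2, x 0 * y 1 - x 1 * y 0] := fun _ _ => rfl
  refine ⟨Fin 3 → K, inferInstance, inferInstance, inferInstance, ?_, ?_⟩
  · refine eq_top_iff.2 fun x _ => ?_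
    have hx : x = x 0 • ⁅(![0, 1, 0] : Fin 3 → K), (![0, 0, 1] : Fin 3 → K)⁆ +
        x 1 • ⁅(![0, 0, 1] : Fin 3 → K), (![1, 0, 0] : Fin 3 → K)⁆ +
        x 2 • ⁅(![1, 0, 0] : Fin 3 → K), (![0, 1, 0] : Fin 3 → K)⁆ := by
      simp only [hlie]
      ext i
      fin_cases i <;> simp
    have h : ∀ a b : Fin 3 → K,
        ⁅a, b⁆ ∈ ⁅(⊤ : LieIdeal K (Fin 3 → K)), (⊤ : LieIdeal K (Fin 3 → K))⁆ :=
      fun a b => LieSubmodule.lie_mem_lie (LieSubmodule.mem_top a) (LieSubmodule.mem_top b)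
    rw [hx]
    exact add_mem (add_mem (SMulMemClass.smul_mem _ (h _ _)) (SMulMemClass.smul_mem _ (h _ _)))
      (SMulMemClass.smul_mem _ (h _ _))
  · rw [LieSubmodule.eq_bot_iff]
    intro c hc
    have h1 : ⁅(![1, 0, 0] : Fin 3 → K), c⁆ = 0 := hc _
    have h2 : ⁅(![0, 1, 0] : Fin 3 → K), c⁆ = 0 := hc _
    rw [hlie] at h1 h2
    -- These three coordinates are `-c 2`, `c 1` and `c 2`, `c 0` up to sign and repetition of the
    -- cross product with two basis vectors; together they force `c = 0`.
    have h10 := congrFun h1 1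
    have h11 := congrFun h1 2
    have h20 := congrFun h2 2
    simp at h10 h11 h20
    ext i
    fin_cases i <;> simp [*]

theorem corollary5p6 (K : Type u) [Field K] :
    (∀ (L : Type v) [LieRing L] [LieAlgebra K L], LieAlgebra.IsPerfect K L →
      ¬ LieAlgebra.IsCapable.{u, max u v, w} K (L × AbelianLine K) ∧
      (LeibnizAlgebra.IsCapable.{u, max u v, w} K (L × AbelianLine K) ↔
        LieAlgebra.center K L = ⊥)) ∧
    (∃ (A : Type u) (_ : LieRing A) (_ : LieAlgebra K A),
      Module.rank K A ≠ 1 ∧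
      LeibnizAlgebra.IsCapable.{u, u, w} K A ∧ ¬ LieAlgebra.IsCapable.{u, u, w} K A) := by
  refine ⟨fun L _ _ hL => ⟨LieAlgebra.not_isCapable_prod_line hL,
    LeibnizAlgebra.isCapable_prod_line_iff hL⟩, ?_⟩
  obtain ⟨L, _, _, _, hL, hZ⟩ := LieAlgebra.exists_isPerfect_center_eq_bot K
  refine ⟨L × AbelianLine K, inferInstance, inferInstance, fun h => ?_,
    LeibnizAlgebra.isCapable_prod_line hZ, LieAlgebra.not_isCapable_prod_line hL⟩
  have h1 : Module.rank K (AbelianLine K) = 1 := Module.rank_self K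
  -- `L` is nonzero, so the product has rank at least two.
  have h2 : (1 : Cardinal) ≤ Module.rank K L :=
    Cardinal.one_le_iff_ne_zero.2 (rank_pos_iff_nontrivial.2 inferInstance).ne'
  rw [rank_prod', h1] at h
  have h3 := add_le_add_left h2 1
  rw [h] at h3
  exact absurd h3 (by norm_num)
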